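/- Let $n\ge 0$ and let $SYT_n$ be the set of standard Young tableaux with $n$ boxes. For $S\in SYT_n$ and $1\le i<j\le n$ let $S_{[i,j]}$ be the standard Young tableau obtained by restricting $S$ to the entries in $[i,j]$, rectifying the resulting skew tableau to a straight shape by jeu de taquin slides into inner corners, and subtracting $i-1$ from every entry; let $\mathrm{sh}$ denote the shape. For partitions $\lambda,\mu$ of the same number write $\lambda\le^{opp}_{dom}\mu$ if $\lambda_1+\dots+\lambda_k\ge\mu_1+\dots+\mu_k$ for all $k$, and $\lambda<^{opp}_{dom}\mu$ if moreover $\lambda\ne\mu$. The sequence of horizontal strips $\mathrm{SHS}(S)$ is the decomposition of $1,2,\dots,n$ into the smallest possible number of blocks of consecutive integers such that, in $S$, the entries of each block form a horizontal strip filled from left to right (that is, for $x<y$ in the same block, $y$ is in a column strictly to the right of that of $x$). A decomposition $t$ is a one-step refinement of $s$ if every block of $t$ is contained in a block of $s$ and $t$ has exactly one block more than $s$. The chain-strip order $\le_{C\text{-}S}$ on $SYT_n$ is the transitive closure of the following relation between $S$ and $T$: (1) for all $1\le i<j\le n$, either $\mathrm{sh}(S_{[i,j]})<^{opp}_{dom}\mathrm{sh}(T_{[i,j]})$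 or $S_{[i,j]}=T_{[i,j]}$; and (2) $\mathrm{SHS}(T)$ is equal to, or a one-step refinement of, $\mathrm{SHS}(S)$. It is a partial order. For $T\in SYT_n$, Schützenberger's evacuation $T^{evac}$ is defined as follows: $n$ times in succession, remove the smallest entry of the current tableau (it is in the upper left corner) and perform the jeu de taquin slide into that cell; the cell vacated at the $k$-th time receives the entry $n+1-k$ in $T^{evac}$. Then $T\mapsto T^{evac}$ is a well-defined map $SYT_n\to SYT_n$ and is an automorphism of the poset $(SYT_n,\le_{C\text{-}S})$: it is a bijection, and $S\le_{C\text{-}S}T$ if and only if $S^{evac}\le_{C\text{-}S}T^{evac}$, for all $S,T\in SYT_n$. -/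

import Mathlib

/-- A standard Young tableau with `n` boxes (English notation; the cell `(i, j)` is in row `i` and
column `j`, both counted from `0`): a Young diagram filled with the numbers `1, …, n`, each used
exactly once, strictly increasing along rows and down columns. Outside of the diagram the entry
is `0`, which marks an empty cell. -/
structure SYT (n : ℕ) where
  shape : YoungDiagram
  entry : ℕ × ℕ → ℕ
  entry_eq_zero : ∀ c, c ∉ shape → entry c = 0
  bijOn : Set.BijOn entry (shape : Set (ℕ × ℕ)) (Set.Icc 1 n)
  row_lt : ∀ i j₁ j₂, j₁ < j₂ → (i, j₂) ∈ shape → entry (i, j₁) < entry (i, j₂)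
  col_lt : ∀ i₁ i₂ j, i₁ < i₂ → (i₂, j) ∈ shape → entry (i₁, j) < entry (i₂, j)

/-! ### Jeu de taquin

A (skew) tableau is handled as a filling `F : ℕ × ℕ → ℕ`, where `F c = 0` means that `c` is empty. -/

/-- One move of a jeu de taquin slide, for a filling with a hole at `c`: the smaller one of the
entries directly to the right of and directly below the hole moves into the hole, and the hole
takes its place. Nothing changes if both of these cells are empty. -/
def slideStep (s : (ℕ × ℕ → ℕ) × (ℕ × ℕ)) : (ℕ × ℕ → ℕ) × (ℕ × ℕ) :=
  let F := s.1
  let c := s.2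
  let right := (c.1, c.2 + 1)
  let down := (c.1 + 1, c.2)
  if F right = 0 ∧ F down = 0 then s
  else
    let c' := if F right = 0 ∨ (F down ≠ 0 ∧ F down < F right) then down else right
    (Function.update (Function.update F c (F c')) c' 0, c')

/-- The jeu de taquin slide of `F` into the empty cell `c`, where `F` has at most `N` entries (so
that it is over after at most `N` moves): the resulting filling, and the cell that is vacated. -/
def slide (N : ℕ) (F : ℕ × ℕ → ℕ) (c : ℕ × ℕ) : (ℕ × ℕ → ℕ) × (ℕ × ℕ) :=
  slideStep^[N] (F, c)

/-- Schützenberger's operator `Δ` on a tableau with `N` entries: remove the smallest entry, which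
is in the cell `(0, 0)`, and slide into that cell. The second component is the vacated cell. -/
def schutzDelta (N : ℕ) (F : ℕ × ℕ → ℕ) : (ℕ × ℕ → ℕ) × (ℕ × ℕ) :=
  slide N (Function.update F (0, 0) 0) (0, 0)

/-- The evacuation of a tableau with `n` entries: the cell vacated by the `k`-th one of `n`
successive applications of `Δ` receives the entry `n + 1 - k`. -/
def evac : (n : ℕ) → (ℕ × ℕ → ℕ) → (ℕ × ℕ → ℕ)
  | 0, _ => fun _ => 0
  | n + 1, F =>
    Function.update (evac n (schutzDelta (n + 1) F).1) (schutzDelta (n + 1) F).2 (n + 1)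

/-- The cells of a tableau with `n` entries, in the order in which they are vacated by `n`
successive applications of `Δ`. Each one is a corner of the shape that is left at that time. -/
def vacated : (n : ℕ) → (ℕ × ℕ → ℕ) → List (ℕ × ℕ)
  | 0, _ => []
  | n + 1, F => (schutzDelta (n + 1) F).2 :: vacated n (schutzDelta (n + 1) F).1

namespace SYT

/-- The tableau `S_{[i,j]}`: restrict `S` to the entries in `[i, j]`, slide this skew tableau into
inner corners until its shape is straight, and subtract `i - 1` from all entries.

The straight tableau does not depend on the order in which the cells of the inner shape (those
with entries `< i`) are used, as long as each one is a corner of the inner shape that is left;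
the order in which evacuation of the inner tableau vacates them is one such order. -/
def seg {n : ℕ} (S : SYT n) (i j : ℕ) : ℕ × ℕ → ℕ :=
  let inner : ℕ × ℕ → ℕ := fun c => if S.entry c < i then S.entry c else 0
  let skew : ℕ × ℕ → ℕ := fun c => if i ≤ S.entry c ∧ S.entry c ≤ j then S.entry c else 0
  let rect := (vacated (i - 1) inner).foldl (fun F c => (slide n F c).1) skew
  fun c => rect c - (i - 1)

end SYT

/-! ### Opposite dominance order on shapes -/

/-- The length of row `r` of a shape, given as its set of cells. -/
noncomputable def shapeRowLen (lam : Set (ℕ × ℕ)) (r : ℕ) : ℕ :=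
  {c ∈ lam | c.1 = r}.ncard

/-- `lam ≤ mu` in the opposite dominance order. -/
def OppDomLE (lam mu : Set (ℕ × ℕ)) : Prop :=
  ∀ k : ℕ, ∑ r ∈ Finset.range k, shapeRowLen mu r ≤ ∑ r ∈ Finset.range k, shapeRowLen lam r

/-- `lam < mu` in the opposite dominance order. -/
def OppDomLT (lam mu : Set (ℕ × ℕ)) : Prop :=
  OppDomLE lam mu ∧ lam ≠ mu

/-! ### Sequences of horizontal strips

A sequence of `k` sequences of consecutive numbers which together are `1, …, n` is given by the
numbers `0 = m₀ < m₁ < ⋯ < m_k = n` after which a sequence ends: an element of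
`CompositionAsSet n`, whose `length` is `k`. -/

/-- The set partition of `[n]` underlying such a sequence; `x : Fin n` stands for the number
`x + 1`. The order on `Setoid (Fin n)` is refinement, finer partitions being smaller. -/
def setPartition {n : ℕ} (s : CompositionAsSet n) : Setoid (Fin n) where
  r x y := ∀ m ∈ s.boundaries, (x : ℕ) + 1 ≤ (m : ℕ) ↔ (y : ℕ) + 1 ≤ (m : ℕ)
  iseqv := ⟨fun _ _ _ => Iff.rfl, fun h m hm => (h m hm).symm,
    fun h h' m hm => (h m hm).trans (h' m hm)⟩

/-- `t` is a one-step refinement of `s`. -/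
def OneStepRefinement {n : ℕ} (t s : CompositionAsSet n) : Prop :=
  setPartition t ≤ setPartition s ∧ t.length = s.length + 1

namespace SYT

/-- `s` cuts `S` into horizontal strips, each one filled from left to right: of two numbers in the
same part of `s`, the larger one is in a column further to the right (in particular, no column
contains two of them). -/
def IsStripChain {n : ℕ} (S : SYT n) (s : CompositionAsSet n) : Prop :=
  ∀ x y : Fin n, x < y → setPartition s x y →
    ∀ p q : ℕ × ℕ, S.entry p = x + 1 → S.entry q = y + 1 → p.2 < q.2

theorem exists_growthChain {n : ℕ} (S : SYT n) :
    ∃ s : CompositionAsSet n, S.IsStripChain s ∧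
      ∀ s', S.IsStripChain s' → s.length ≤ s'.length := by
  classical
  have hne : ∃ s : CompositionAsSet n, S.IsStripChain s := by
    refine ⟨⟨Finset.univ, Finset.mem_univ _, Finset.mem_univ _⟩, ?_⟩
    intro x y hxy h
    have := (h ⟨(x : ℕ) + 1, by omega⟩ (Finset.mem_univ _)).1 (by simp)
    have hxy' : (x : ℕ) < y := hxy
    simp only at this
    omega
  obtain ⟨s, hs, hmin⟩ := Set.exists_min_image {s | S.IsStripChain s}
    CompositionAsSet.length (Set.toFinite _) hne
  exact ⟨s, hs, hmin⟩

/-- The sequence of horizontal strips of `S`: the one of its growth chain, that is, of its shortest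
chain of horizontal strips. (It is unique: a new strip starts at `x + 1` exactly if `x + 1` is in a
lower row than `x`.) -/
noncomputable def SHS {n : ℕ} (S : SYT n) : CompositionAsSet n :=
  Classical.choose S.exists_growthChain

/-- The relation whose transitive closure is the chain-strip order. -/
def ChainStripRel {n : ℕ} (S T : SYT n) : Prop :=
  (∀ i j : ℕ, 1 ≤ i → i < j → j ≤ n →
    OppDomLT (Function.support (S.seg i j)) (Function.support (T.seg i j)) ∨
      S.seg i j = T.seg i j) ∧
  (T.SHS = S.SHS ∨ OneStepRefinement T.SHS S.SHS)

theorem support_entry {n : ℕ} (S : SYT n) : Function.support S.entry = S.shape := by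
  ext c
  simp only [Function.mem_support, SetLike.mem_coe]
  constructor
  · intro h
    by_contra hc
    exact h (S.entry_eq_zero c hc)
  · intro h
    have := (S.bijOn.mapsTo h).1
    omega

theorem ext_entry {n : ℕ} {S T : SYT n} (h : S.entry = T.entry) : S = T := by
  have hs : S.shape = T.shape := by
    apply SetLike.coe_injective
    rw [← S.support_entry, ← T.support_entry, h]
  cases S
  cases T
  simp_all

theorem seg_full {n : ℕ} (S : SYT n) : S.seg 1 n = S.entry := by
  funext c
  by_cases hc : c ∈ S.shape
  · have h : 1 ≤ S.entry c ∧ S.entry c ≤ n := S.bijOn.mapsTo hc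
    simp [seg, vacated, h.1, h.2]
  · simp [seg, vacated, S.entry_eq_zero c hc]

theorem eq_of_le_one {n : ℕ} (hn : n ≤ 1) (S T : SYT n) : S = T := by
  have key : ∀ (S : SYT n) (c : ℕ × ℕ), S.entry c = if c = (0, 0) then n else 0 := by
    intro S c
    have hzero : ∀ d, d ∈ S.shape → d = (0, 0) ∧ S.entry d = n := by
      intro d hd
      have h0 : (0, 0) ∈ S.shape := S.shape.up_left_mem (Nat.zero_le _) (Nat.zero_le _) hd
      have h1 : 1 ≤ S.entry d ∧ S.entry d ≤ n := S.bijOn.mapsTo hd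
      have h2 : 1 ≤ S.entry (0, 0) ∧ S.entry (0, 0) ≤ n := S.bijOn.mapsTo h0
      exact ⟨S.bijOn.injOn hd h0 (by omega), by omega⟩
    by_cases hc : c ∈ S.shape
    · obtain ⟨h1, h2⟩ := hzero c hc
      rw [if_pos h1, h2]
    · rw [S.entry_eq_zero c hc]
      split_ifs with h
      · by_contra hn0
        obtain ⟨d, hd, -⟩ := S.bijOn.surjOn (show n ∈ Set.Icc 1 n from ⟨by omega, le_rfl⟩)
        exact hc (h ▸ (hzero d hd).1 ▸ hd)
      · rfl
  exact ext_entry (funext fun c => by rw [key S, key T])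

theorem shapeRowLen_coe (μ : YoungDiagram) (r : ℕ) :
    shapeRowLen (μ : Set (ℕ × ℕ)) r = μ.rowLen r := by
  rw [YoungDiagram.rowLen_eq_card, ← Set.ncard_coe_finset, shapeRowLen]
  congr 1
  ext c
  simp [YoungDiagram.mem_row_iff]

theorem oppDomLE_antisymm {μ ν : YoungDiagram} (h : OppDomLE (μ : Set (ℕ × ℕ)) ν)
    (h' : OppDomLE (ν : Set (ℕ × ℕ)) μ) : μ = ν := by
  have hsum : ∀ k, ∑ r ∈ Finset.range k, μ.rowLen r = ∑ r ∈ Finset.range k, ν.rowLen r := by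
    intro k
    have h1 := h k
    have h2 := h' k
    simp only [shapeRowLen_coe] at h1 h2
    omega
  have hrow : ∀ k, μ.rowLen k = ν.rowLen k := by
    intro k
    have h1 := hsum (k + 1)
    rw [Finset.sum_range_succ, Finset.sum_range_succ, hsum k] at h1
    omega
  apply SetLike.ext
  rintro ⟨i, j⟩
  rw [YoungDiagram.mem_iff_lt_rowLen, YoungDiagram.mem_iff_lt_rowLen, hrow]

theorem transGen_chainStripRel {n : ℕ} (hn : 1 < n) {S T : SYT n}
    (h : Relation.TransGen ChainStripRel S T) :
    S = T ∨ OppDomLT (S.shape : Set (ℕ × ℕ)) T.shape := by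
  have step : ∀ {S T : SYT n}, ChainStripRel S T →
      S = T ∨ OppDomLT (S.shape : Set (ℕ × ℕ)) T.shape := by
    intro S T h
    have := h.1 1 n le_rfl hn le_rfl
    rw [seg_full, seg_full, support_entry, support_entry] at this
    exact this.symm.imp_left ext_entry
  induction h with
  | single h => exact step h
  | tail _ h ih =>
    rcases ih with rfl | ih
    · exact step h
    · rcases step h with rfl | h'
      · exact Or.inr ih
      · refine Or.inr ⟨fun k => (h'.1 k).trans (ih.1 k), fun heq => h'.2 ?_⟩
        rw [heq] at ih
        exact congrArg _ (oppDomLE_antisymm h'.1 ih.1)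

/-- The chain-strip order on standard Young tableaux with `n` boxes. -/
instance {n : ℕ} : PartialOrder (SYT n) where
  le := Relation.TransGen ChainStripRel
  le_refl S := Relation.TransGen.single ⟨fun _ _ _ _ _ => Or.inr rfl, Or.inl rfl⟩
  le_trans _ _ _ h h' := h.trans h'
  le_antisymm S T h h' := by
    rcases Nat.lt_or_ge 1 n with hn | hn
    · rcases transGen_chainStripRel hn h with h | h
      · exact h
      · rcases transGen_chainStripRel hn h' with h' | h'
        · exact h'.symm
        · exact absurd (congrArg _ (oppDomLE_antisymm h.1 h'.1)) h.2
    · exact eq_of_le_one hn S T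

end SYT

/-! ### Growth diagrams -/

/-! Evacuation is the reflection of a triangular growth diagram. A tableau is encoded as the word of
its cells in the order of their entries. In row `i` of the diagram, `H i` is the word of the tableau
after `i` applications of `Δ`, and `V i` follows the hole through the next application. A slide
meets the entries in increasing order, and an entry moves exactly if its cell is adjacent to the
hole when its turn comes; this is `localRule`. The rule is an involution, so the reflected array is
again a growth diagram (`IsGrowth.reflect`). Its first row is the last column of `V`, which lists
the vacated cells and hence is the word of the evacuation (`IsGrowth.isFill_evac`). Thus evacuation
is an involution, and it remains to show that it preserves the generating relation.

Up to the shift of its entries, `S_{[i,j]}` is the part of row `i - 1` with indices in `[i - 1, j)`.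
In the reflected diagram this part becomes a piece of a column. Such a column and the row over the
same triangle fill the same diagram and determine each other (`IsGrowth.image_row_eq_image_col`,
`IsGrowth.row_eq_iff`). So the shape and the equality conditions for the evacuations at `[i,j]` are
those for the original tableaux at `[n+1-j, n+1-i]`.

The inner boundaries of `SHS` are the descents of the word. Slides preserve descents
(`localRule_descent`) and reflection reverses their order, so evacuation turns `SHS` around, which
respects equality and one-step refinement. -/

/-- Two cells share an edge. -/
def CellAdj (a b : ℕ × ℕ) : Prop :=
  (a.1 = b.1 ∧ (a.2 + 1 = b.2 ∨ b.2 + 1 = a.2)) ∨ (a.2 = b.2 ∧ (a.1 + 1 = b.1 ∨ b.1 + 1 = a.1))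

theorem CellAdj.symm {a b : ℕ × ℕ} (h : CellAdj a b) : CellAdj b a := by
  unfold CellAdj at *; omega

open Classical in
/-- Fomin's local rule: two cells which are added one after the other to a diagram trade places
unless they are adjacent. -/
noncomputable def localRule (a b : ℕ × ℕ) : (ℕ × ℕ) × (ℕ × ℕ) :=
  if CellAdj a b then (a, b) else (b, a)

theorem localRule_of_adj {a b : ℕ × ℕ} (h : CellAdj a b) : localRule a b = (a, b) := if_pos h

theorem localRule_of_not_adj {a b : ℕ × ℕ} (h : ¬ CellAdj a b) : localRule a b = (b, a) := if_neg h

/-- Adjacency is symmetric, so each square of a growth diagram can also be read from its opposite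
corner. The symmetry of evacuation comes from here. -/
theorem localRule_symm {a b a' b' : ℕ × ℕ} (h : localRule a b = (b', a')) :
    localRule b' a' = (a, b) := by
  by_cases hab : CellAdj a b
  · rw [localRule_of_adj hab, Prod.mk.injEq] at h
    rw [← h.1, ← h.2, localRule_of_adj hab]
  · rw [localRule_of_not_adj hab, Prod.mk.injEq] at h
    rw [← h.1, ← h.2, localRule_of_not_adj fun h' => hab h'.symm]

/-- A triangular growth diagram of size `n`. The word `H i i, H i (i + 1), …, H i (n - 1)` is its
`i`-th row, and `V i j` is the hole which is left after the first letter of this row was removed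
and the following ones, up to the one with index `j`, have been slid. -/
structure IsGrowth (n : ℕ) (H V : ℕ → ℕ → ℕ × ℕ) : Prop where
  diag : ∀ i < n, V i i = H i i
  rule : ∀ i j, i ≤ j → j + 1 < n →
    localRule (V i j) (H i (j + 1)) = (H (i + 1) (j + 1), V i (j + 1))

/-- The holes when the row `f`, which starts at the index `i`, is slid. -/
noncomputable def holeSeq (f : ℕ → ℕ × ℕ) (i : ℕ) : ℕ → ℕ × ℕ
  | 0 => f 0
  -- Before the index `i` the values are placeholders; at `i` itself the hole is the cell of the
  -- removed first letter.
  | j + 1 => if j + 1 ≤ i then f (j + 1) else (localRule (holeSeq f i j) (f (j + 1))).2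

/-- The rows of the growth diagram whose first row is `w`. -/
noncomputable def growthRow (w : ℕ → ℕ × ℕ) : ℕ → ℕ → ℕ × ℕ
  | 0 => w
  | i + 1 => fun j => (localRule (holeSeq (growthRow w i) i (j - 1)) (growthRow w i j)).1

/-- The holes of the growth diagram whose first row is `w`. -/
noncomputable def growthHole (w : ℕ → ℕ × ℕ) (i : ℕ) : ℕ → ℕ × ℕ := holeSeq (growthRow w i) i

theorem isGrowth_growthRow (n : ℕ) (w : ℕ → ℕ × ℕ) : IsGrowth n (growthRow w) (growthHole w) where
  diag i _ := by
    cases i with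
    | zero => rfl
    | succ i => simp [growthHole, holeSeq]
  rule i j hij _ := by
    have h : ¬ (j + 1 ≤ i) := by omega
    simp [growthRow, growthHole, holeSeq, h]

namespace IsGrowth

variable {n : ℕ} {H V H' V' : ℕ → ℕ → ℕ × ℕ}

theorem mono (h : IsGrowth n H V) {m : ℕ} (hm : m ≤ n) : IsGrowth m H V where
  diag i hi := h.diag i (by omega)
  rule i j hij hj := h.rule i j hij (by omega)

/-- The reflection of a growth diagram is a growth diagram. -/
theorem reflect (h : IsGrowth n H V) :
    IsGrowth n (fun i j => V (n - 1 - j) (n - 1 - i)) (fun i j => H (n - 1 - j) (n - 1 - i)) where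
  diag i hi := (h.diag _ (by omega)).symm
  rule i j hij hj := by
    have := localRule_symm (h.rule (n - 1 - (j + 1)) (n - 1 - (i + 1)) (by omega) (by omega))
    rw [show n - 1 - (j + 1) + 1 = n - 1 - j by omega,
      show n - 1 - (i + 1) + 1 = n - 1 - i by omega] at this
    exact this

/-- A part of a row determines the triangle below it. -/
theorem congr (h : IsGrowth n H V) (h' : IsGrowth n H' V') {a b : ℕ} (hb : b ≤ n)
    (hrow : ∀ j, a ≤ j → j < b → H a j = H' a j) (i j : ℕ) (hai : a ≤ i) (hij : i ≤ j)
    (hj : j < b) : H i j = H' i j ∧ V i j = V' i j := by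
  induction i, hai using Nat.le_induction generalizing j with
  | base =>
    refine ⟨hrow j hij hj, ?_⟩
    induction j, hij using Nat.le_induction with
    | base => rw [h.diag _ (by omega), h'.diag _ (by omega), hrow _ le_rfl hj]
    | succ j hij ih =>
      have h1 := h.rule a j hij (by omega)
      have h2 := h'.rule a j hij (by omega)
      rw [ih (by omega), hrow (j + 1) (by omega) hj, h2] at h1
      exact (Prod.mk.inj h1).2.symm
  | succ i hai ih =>
    have key : ∀ j, i + 1 ≤ j → j < b → H (i + 1) j = H' (i + 1) j := by
      intro j hij hj
      obtain ⟨j, rfl⟩ : ∃ k, j = k + 1 := ⟨j - 1, by omega⟩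
      have h1 := h.rule i j (by omega) (by omega)
      have h2 := h'.rule i j (by omega) (by omega)
      rw [(ih j (by omega) (by omega)).2, (ih (j + 1) (by omega) (by omega)).1, h2] at h1
      exact (Prod.mk.inj h1).1.symm
    refine ⟨key j hij hj, ?_⟩
    induction j, hij using Nat.le_induction with
    | base => rw [h.diag _ (by omega), h'.diag _ (by omega), key _ le_rfl hj]
    | succ j hij ih =>
      have h1 := h.rule (i + 1) j hij (by omega)
      have h2 := h'.rule (i + 1) j hij (by omega)
      rw [ih (by omega), key (j + 1) (by omega) hj, h2] at h1
      exact (Prod.mk.inj h1).2.symm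

/-- The top row and the right column of a triangle in a growth diagram determine each other. -/
theorem row_eq_iff (h : IsGrowth n H V) (h' : IsGrowth n H' V') {a b : ℕ} (hb : b ≤ n) :
    (∀ j, a ≤ j → j < b → H a j = H' a j) ↔
      ∀ i, a ≤ i → i < b → V i (b - 1) = V' i (b - 1) := by
  constructor
  · intro hrow i hai hib
    exact (h.congr h' hb hrow i (b - 1) hai (by omega) (by omega)).2
  · intro hcol j haj hjb
    -- Truncating to size `b` before reflecting turns the column `b - 1` into the top row.
    have := ((h.mono hb).reflect.congr (h'.mono hb).reflect (a := 0) (b := b - a) (by omega) ?_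
      (b - 1 - j) (b - 1 - a) (by omega) (by omega) (by omega)).2
    · simpa only [show b - 1 - (b - 1 - a) = a by omega, show b - 1 - (b - 1 - j) = j by omega]
        using this
    · intro k _ hk
      simpa using hcol (b - 1 - k) (by omega) (by omega)

end IsGrowth

/-! ### Standard words of cells -/

theorem image_Ico_succ (f : ℕ → ℕ × ℕ) {i j : ℕ} (hij : i ≤ j) :
    f '' Set.Ico i (j + 1) = insert (f j) (f '' Set.Ico i j) := by
  rw [← Set.insert_Ico_right_eq_Ico_add_one hij, Set.image_insert_eq]

/-- The cells `f i, …, f (n - 1)` are different, and each initial segment of this sequence is a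
Young diagram. -/
structure IsStandard (f : ℕ → ℕ × ℕ) (i n : ℕ) : Prop where
  lower : ∀ j ≤ n, IsLowerSet (f '' Set.Ico i j)
  notMem : ∀ j, i ≤ j → j < n → f j ∉ f '' Set.Ico i j

theorem IsStandard.mono {f : ℕ → ℕ × ℕ} {i n m : ℕ} (h : IsStandard f i n) (hm : m ≤ n) :
    IsStandard f i m where
  lower j hj := h.lower j (hj.trans hm)
  notMem j hij hj := h.notMem j hij (hj.trans_le hm)

theorem IsStandard.first {f : ℕ → ℕ × ℕ} {i n : ℕ} (h : IsStandard f i n) (hi : i < n) :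
    f i = (0, 0) := by
  have h1 := h.lower (i + 1) hi
  rw [image_Ico_succ f le_rfl] at h1
  simp only [Set.Ico_self, Set.image_empty, insert_empty_eq] at h1
  exact (h1 (show ((0, 0) : ℕ × ℕ) ≤ f i from ⟨Nat.zero_le _, Nat.zero_le _⟩) rfl).symm

/-- Of two neighbouring cells, the one which is added later is the right or the lower one. -/
theorem adj_cases {D : Set (ℕ × ℕ)} {a b : ℕ × ℕ} (ha : IsLowerSet (insert a D))
    (hb : b ∉ insert a D) (hab : CellAdj a b) : b = (a.1, a.2 + 1) ∨ b = (a.1 + 1, a.2) := by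
  have h : ¬ b ≤ a := fun h => hb (ha h (Set.mem_insert _ _))
  rw [Prod.le_def] at h
  simp only [Prod.ext_iff]
  unfold CellAdj at hab
  omega

/-- If two cells which are not neighbours can be added to a diagram one after the other, then the
second one can be added first. -/
theorem isLowerSet_insert_of_not_adj {M : Set (ℕ × ℕ)} {a b : ℕ × ℕ} (hM : IsLowerSet M)
    (ha : a ∉ M) (hb : b ∉ insert a M) (hbl : IsLowerSet (insert b (insert a M)))
    (hab : ¬ CellAdj a b) : IsLowerSet (insert b M) := by
  have hle : ¬ a ≤ b := by
    intro hle
    have hne : a ≠ b := fun h => hb (h ▸ Set.mem_insert _ _)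
    -- As `a` and `b` are not adjacent, some cell `q` lies strictly between them. It has to belong
    -- to `M`, and then so does `a`, a contradiction.
    obtain ⟨q, hq1, hq2, hq3, hq4⟩ : ∃ q : ℕ × ℕ, a ≤ q ∧ q ≤ b ∧ q ≠ a ∧ q ≠ b := by
      obtain ⟨a1, a2⟩ := a
      obtain ⟨b1, b2⟩ := b
      simp only [Prod.mk_le_mk, ne_eq, Prod.mk.injEq, CellAdj] at hle hne hab
      rcases Nat.lt_or_ge a1 b1 with h | h
      · refine ⟨(b1 - 1, b2), ?_, ?_, ?_, ?_⟩ <;>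
          simp only [Prod.mk_le_mk, ne_eq, Prod.mk.injEq] <;> omega
      · refine ⟨(b1, b2 - 1), ?_, ?_, ?_, ?_⟩ <;>
          simp only [Prod.mk_le_mk, ne_eq, Prod.mk.injEq] <;> omega
    rcases hbl hq2 (Set.mem_insert _ _) with h | h | h
    · exact hq4 h
    · exact hq3 h
    · exact ha (hM hq1 h)
  intro p q hqp hp
  rcases hp with rfl | hp
  · rcases hbl hqp (Set.mem_insert _ _) with h | h | h
    · exact Or.inl h
    · exact absurd (h ▸ hqp) hle
    · exact Or.inr h
  · exact Or.inr (hM hqp hp)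

/-- Both orders of adding the two cells reach the same diagram; a swap is legitimate because the
second cell is already addable to `M`. -/
theorem localRule_standard {M : Set (ℕ × ℕ)} {a b a' b' : ℕ × ℕ} (hM : IsLowerSet M)
    (ha : a ∉ M) (hal : IsLowerSet (insert a M)) (hb : b ∉ insert a M)
    (hbl : IsLowerSet (insert b (insert a M))) (h : localRule a b = (b', a')) :
    b' ∉ M ∧ IsLowerSet (insert b' M) ∧ a' ∉ insert b' M ∧
      insert b (insert a M) = insert a' (insert b' M) := by
  by_cases hab : CellAdj a b
  · rw [localRule_of_adj hab, Prod.mk.injEq] at h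
    obtain ⟨rfl, rfl⟩ := h
    exact ⟨ha, hal, hb, rfl⟩
  · rw [localRule_of_not_adj hab, Prod.mk.injEq] at h
    obtain ⟨rfl, rfl⟩ := h
    refine ⟨fun h => hb (Or.inr h), isLowerSet_insert_of_not_adj hM ha hb hbl hab, ?_,
      Set.insert_comm _ _ _⟩
    rintro (h | h)
    · exact hb (h ▸ Set.mem_insert _ _)
    · exact ha h

namespace IsGrowth

variable {n : ℕ} {H V : ℕ → ℕ → ℕ × ℕ}

/-- Invariant of a slide: the letters already moved form a diagram, which the hole completes to the
diagram of the old row. The last clause is the next instance of the invariant, together with the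
fact that the new letter is a new cell. -/
theorem next_aux (h : IsGrowth n H V) {i : ℕ} (hs : IsStandard (H i) i n) (j : ℕ) (hij : i ≤ j)
    (hj : j < n) :
    IsLowerSet (H (i + 1) '' Set.Ico (i + 1) (j + 1)) ∧
    V i j ∉ H (i + 1) '' Set.Ico (i + 1) (j + 1) ∧
    H i '' Set.Ico i (j + 1) = insert (V i j) (H (i + 1) '' Set.Ico (i + 1) (j + 1)) ∧
    (j + 1 < n → H (i + 1) (j + 1) ∉ H (i + 1) '' Set.Ico (i + 1) (j + 1) ∧
      IsLowerSet (H (i + 1) '' Set.Ico (i + 1) (j + 2)) ∧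
      V i (j + 1) ∉ H (i + 1) '' Set.Ico (i + 1) (j + 2) ∧
      H i '' Set.Ico i (j + 2) = insert (V i (j + 1)) (H (i + 1) '' Set.Ico (i + 1) (j + 2))) := by
  have step : ∀ j, i ≤ j → j + 1 < n → IsLowerSet (H (i + 1) '' Set.Ico (i + 1) (j + 1)) →
      V i j ∉ H (i + 1) '' Set.Ico (i + 1) (j + 1) →
      H i '' Set.Ico i (j + 1) = insert (V i j) (H (i + 1) '' Set.Ico (i + 1) (j + 1)) →
      H (i + 1) (j + 1) ∉ H (i + 1) '' Set.Ico (i + 1) (j + 1) ∧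
      IsLowerSet (H (i + 1) '' Set.Ico (i + 1) (j + 2)) ∧
      V i (j + 1) ∉ H (i + 1) '' Set.Ico (i + 1) (j + 2) ∧
      H i '' Set.Ico i (j + 2) =
        insert (V i (j + 1)) (H (i + 1) '' Set.Ico (i + 1) (j + 2)) := by
    intro j hij hj h1 h2 h3
    have e1 := image_Ico_succ (H i) (i := i) (j := j + 1) (by omega)
    have e2 := image_Ico_succ (H (i + 1)) (i := i + 1) (j := j + 1) (by omega)
    rw [show j + 2 = j + 1 + 1 from rfl, e2, e1, h3]
    refine localRule_standard h1 h2 (h3 ▸ hs.lower _ (by omega))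
      (h3 ▸ hs.notMem (j + 1) (by omega) hj) ?_ (h.rule i j hij hj)
    rw [← h3, ← e1]
    exact hs.lower _ (by omega)
  induction j, hij using Nat.le_induction with
  | base =>
    have h0 : H (i + 1) '' Set.Ico (i + 1) (i + 1) = ∅ := by simp
    have h3 : H i '' Set.Ico i (i + 1) =
        insert (V i i) (H (i + 1) '' Set.Ico (i + 1) (i + 1)) := by
      rw [image_Ico_succ _ le_rfl, h0, h.diag i hj, Set.Ico_self, Set.image_empty]
    have h1 : IsLowerSet (H (i + 1) '' Set.Ico (i + 1) (i + 1)) := h0 ▸ isLowerSet_empty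
    have h2 : V i i ∉ H (i + 1) '' Set.Ico (i + 1) (i + 1) := h0 ▸ Set.notMem_empty _
    exact ⟨h1, h2, h3, fun hj' => step i le_rfl hj' h1 h2 h3⟩
  | succ j hij ih =>
    obtain ⟨-, -, -, h4⟩ := ih (by omega)
    obtain ⟨-, h1, h2, h3⟩ := h4 hj
    exact ⟨h1, h2, h3, fun hj' => step (j + 1) (by omega) hj' h1 h2 h3⟩

theorem hole_notMem (h : IsGrowth n H V) {i : ℕ} (hs : IsStandard (H i) i n) {j : ℕ} (hij : i ≤ j)
    (hj : j < n) : V i j ∉ H (i + 1) '' Set.Ico (i + 1) (j + 1) :=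
  (h.next_aux hs j hij hj).2.1

theorem image_row (h : IsGrowth n H V) {i : ℕ} (hs : IsStandard (H i) i n) {j : ℕ} (hij : i ≤ j)
    (hj : j < n) :
    H i '' Set.Ico i (j + 1) = insert (V i j) (H (i + 1) '' Set.Ico (i + 1) (j + 1)) :=
  (h.next_aux hs j hij hj).2.2.1

theorem standard_succ (h : IsGrowth n H V) {i : ℕ} (hs : IsStandard (H i) i n) :
    IsStandard (H (i + 1)) (i + 1) n where
  lower j hj := by
    rcases Nat.lt_or_ge i j with hij | hij
    · obtain ⟨j, rfl⟩ : ∃ k, j = k + 1 := ⟨j - 1, by omega⟩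
      exact (h.next_aux hs j (by omega) (by omega)).1
    · rw [Set.Ico_eq_empty (by omega), Set.image_empty]
      exact isLowerSet_empty
  notMem j hij hj := by
    obtain ⟨j, rfl⟩ : ∃ k, j = k + 1 := ⟨j - 1, by omega⟩
    exact ((h.next_aux hs j (by omega) (by omega)).2.2.2 hj).1

theorem standard (h : IsGrowth n H V) (hs : IsStandard (H 0) 0 n) (i : ℕ) :
    IsStandard (H i) i n := by
  induction i with
  | zero => exact hs
  | succ i ih => exact h.standard_succ ih

/-- A row and a column which end in the same place fill the same diagram. -/
theorem image_row_eq_image_col (h : IsGrowth n H V) (hs : IsStandard (H 0) 0 n) {j : ℕ} (hj : j ≤ n)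
    (i : ℕ) (hij : i ≤ j) :
    H i '' Set.Ico i j = (fun k => V k (j - 1)) '' Set.Ico i j := by
  induction hij using Nat.decreasingInduction with
  | self => simp
  | of_succ i hij ih =>
    obtain ⟨j, rfl⟩ : ∃ k, j = k + 1 := ⟨j - 1, by omega⟩
    rw [h.image_row (h.standard hs i) (by omega) (by omega), ih,
      ← Set.insert_Ico_add_one_left_eq_Ico (show i < j + 1 by omega), Set.image_insert_eq]
    rfl

/-- The left side is a piece of the column `n - 1 - i`, starting in row `n - j`; the row over the
same triangle fills the same diagram. -/
theorem image_reflect_row (h : IsGrowth n H V) (hs : IsStandard (H 0) 0 n) {i j : ℕ} (hij : i ≤ j)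
    (hj : j ≤ n) :
    (fun k => V (n - 1 - k) (n - 1 - i)) '' Set.Ico i j =
      H (n - j) '' Set.Ico (n - j) (n - i) := by
  rw [h.image_row_eq_image_col hs (by omega) _ (by omega)]
  ext c
  simp only [Set.mem_image, Set.mem_Ico]
  constructor
  · rintro ⟨k, hk, rfl⟩
    exact ⟨n - 1 - k, by omega, by rw [show n - i - 1 = n - 1 - i by omega]⟩
  · rintro ⟨k, hk, rfl⟩
    exact ⟨n - 1 - k, by omega, by
      rw [show n - i - 1 = n - 1 - i by omega, show n - 1 - (n - 1 - k) = k by omega]⟩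

theorem standard_reflect (h : IsGrowth n H V) (hs : IsStandard (H 0) 0 n) :
    IsStandard (fun j => V (n - 1 - j) (n - 1)) 0 n where
  lower j hj := by
    have := h.image_reflect_row hs (Nat.zero_le j) hj
    rw [Nat.sub_zero] at this
    rw [this]
    exact (h.standard hs _).lower _ le_rfl
  notMem j _ hj := by
    have := h.image_reflect_row hs (Nat.zero_le j) hj.le
    rw [Nat.sub_zero] at this
    rw [this]
    have h2 := h.hole_notMem (h.standard hs (n - 1 - j)) (j := n - 1) (by omega) (by omega)
    rwa [show n - 1 - j + 1 = n - j by omega, show n - 1 + 1 = n by omega] at h2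

end IsGrowth

/-! ### Slides of fillings -/

/-- `F` has the entry `k + 1` in the cell `f k`, for `a ≤ k < b`, and no other entries. -/
structure IsFill (F : ℕ × ℕ → ℕ) (f : ℕ → ℕ × ℕ) (a b : ℕ) : Prop where
  apply : ∀ k, a ≤ k → k < b → F (f k) = k + 1
  exists_of_ne : ∀ c, F c ≠ 0 → ∃ k, a ≤ k ∧ k < b ∧ f k = c

namespace IsFill

variable {F G : ℕ × ℕ → ℕ} {f g : ℕ → ℕ × ℕ} {a b : ℕ}

theorem eq_zero (h : IsFill F f a b) {c : ℕ × ℕ} (hc : c ∉ f '' Set.Ico a b) : F c = 0 := by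
  by_contra h0
  obtain ⟨k, hk1, hk2, rfl⟩ := h.exists_of_ne c h0
  exact hc ⟨k, ⟨hk1, hk2⟩, rfl⟩

theorem support_eq (h : IsFill F f a b) : Function.support F = f '' Set.Ico a b := by
  ext c
  constructor
  · intro hc
    by_contra h0
    exact hc (h.eq_zero h0)
  · rintro ⟨k, ⟨hk1, hk2⟩, rfl⟩
    simp [h.apply k hk1 hk2]

theorem injOn (h : IsFill F f a b) : Set.InjOn f (Set.Ico a b) := by
  intro x hx y hy hxy
  have h1 := h.apply x hx.1 hx.2
  rw [hxy, h.apply y hy.1 hy.2] at h1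
  omega

theorem unique (h : IsFill F f a b) (h' : IsFill G f a b) : F = G := by
  funext c
  by_cases hc : c ∈ f '' Set.Ico a b
  · obtain ⟨k, hk, rfl⟩ := hc
    rw [h.apply k hk.1 hk.2, h'.apply k hk.1 hk.2]
  · rw [h.eq_zero hc, h'.eq_zero hc]

theorem congr (h : IsFill F f a b) (hfg : ∀ k, a ≤ k → k < b → f k = g k) : IsFill F g a b where
  apply k h1 h2 := by rw [← hfg k h1 h2, h.apply k h1 h2]
  exists_of_ne c hc := by
    obtain ⟨k, h1, h2, rfl⟩ := h.exists_of_ne c hc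
    exact ⟨k, h1, h2, (hfg k h1 h2).symm⟩

theorem eq_iff (h : IsFill F f a b) (h' : IsFill G g a b) :
    F = G ↔ ∀ k, a ≤ k → k < b → f k = g k := by
  constructor
  · rintro rfl k h1 h2
    obtain ⟨l, h3, h4, h5⟩ := h'.exists_of_ne (f k) (by rw [h.apply k h1 h2]; omega)
    have h6 := h'.apply l h3 h4
    rw [h5, h.apply k h1 h2] at h6
    rw [← h5, show k = l by omega]
  · exact fun hfg => (h.congr hfg).unique h'

theorem le (h : IsFill F f a b) (c : ℕ × ℕ) : F c ≤ b := by
  by_cases hc : F c = 0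
  · omega
  · obtain ⟨k, h1, h2, rfl⟩ := h.exists_of_ne c hc
    rw [h.apply k h1 h2]
    omega

theorem snoc (h : IsFill F f a b) (hab : a ≤ b) (hb : f b ∉ f '' Set.Ico a b) :
    IsFill (Function.update F (f b) (b + 1)) f a (b + 1) where
  apply k h1 h2 := by
    rcases Nat.lt_or_ge k b with hk | hk
    · rw [Function.update_of_ne, h.apply k h1 hk]
      exact fun he => hb ⟨k, ⟨h1, hk⟩, he⟩
    · obtain rfl : k = b := by omega
      rw [Function.update_self]
  exists_of_ne c hc := by
    by_cases hcb : c = f b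
    · exact ⟨b, hab, by omega, hcb.symm⟩
    · rw [Function.update_of_ne hcb] at hc
      obtain ⟨k, h1, h2, h3⟩ := h.exists_of_ne c hc
      exact ⟨k, h1, by omega, h3⟩

theorem dropLast (h : IsFill F f a (b + 1)) (hab : a ≤ b) :
    IsFill (Function.update F (f b) 0) f a b where
  apply k h1 h2 := by
    rw [Function.update_of_ne, h.apply k h1 (by omega)]
    intro he
    have := h.injOn ⟨h1, by omega⟩ ⟨hab, by omega⟩ he
    omega
  exists_of_ne c hc := by
    by_cases hcb : c = f b
    · simp [hcb] at hc
    · rw [Function.update_of_ne hcb] at hc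
      obtain ⟨k, h1, h2, h3⟩ := h.exists_of_ne c hc
      refine ⟨k, h1, ?_, h3⟩
      rcases Nat.lt_or_ge k b with hk | hk
      · exact hk
      · exact absurd (by rw [← h3, show k = b by omega]) hcb

theorem tail (h : IsFill F f a b) (hab : a < b) :
    IsFill (Function.update F (f a) 0) f (a + 1) b where
  apply k h1 h2 := by
    rw [Function.update_of_ne, h.apply k (by omega) (by omega)]
    intro he
    have := h.injOn ⟨by omega, h2⟩ ⟨le_rfl, hab⟩ he
    omega
  exists_of_ne c hc := by
    by_cases hca : c = f a
    · simp [hca] at hc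
    · rw [Function.update_of_ne hca] at hc
      obtain ⟨k, h1, h2, h3⟩ := h.exists_of_ne c hc
      refine ⟨k, ?_, h2, h3⟩
      rcases Nat.lt_or_ge a k with hk | hk
      · exact hk
      · exact absurd (by rw [← h3, show k = a by omega]) hca

/-- The restriction of a filling to the entries in an interval. -/
theorem restrict (h : IsFill F f a b) {a' b' : ℕ} (ha : a ≤ a') (hb : b' ≤ b) {P : ℕ → Prop}
    [DecidablePred P] (hP : ∀ x, a < x → x ≤ b → (P x ↔ a' < x ∧ x ≤ b')) :
    IsFill (fun c => if P (F c) then F c else 0) f a' b' where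
  apply k h1 h2 := by
    have hk := h.apply k (by omega) (by omega)
    simp only [hk]
    rw [if_pos ((hP _ (by omega) (by omega)).2 ⟨by omega, by omega⟩)]
  exists_of_ne c hc := by
    have hc' : P (F c) ∧ F c ≠ 0 := by
      by_contra hcon
      apply hc
      by_cases h1 : P (F c)
      · simpa [h1] using hcon
      · simp [h1]
    obtain ⟨k, h1, h2, rfl⟩ := h.exists_of_ne c hc'.2
    have hk := h.apply k h1 h2
    have := (hP _ (by omega) (by omega)).1 (hk ▸ hc'.1)
    exact ⟨k, by omega, by omega, rfl⟩

end IsFill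

/-- `m` actual moves of a jeu de taquin slide. -/
inductive MovesTo : ℕ → (ℕ × ℕ → ℕ) × (ℕ × ℕ) → (ℕ × ℕ → ℕ) × (ℕ × ℕ) → Prop
  | refl (s) : MovesTo 0 s s
  | step {m s t} (hs : ¬ (s.1 (s.2.1, s.2.2 + 1) = 0 ∧ s.1 (s.2.1 + 1, s.2.2) = 0))
      (h : MovesTo m (slideStep s) t) : MovesTo (m + 1) s t

theorem MovesTo.snoc {m : ℕ} {s t : (ℕ × ℕ → ℕ) × (ℕ × ℕ)} (h : MovesTo m s t)
    (ht : ¬ (t.1 (t.2.1, t.2.2 + 1) = 0 ∧ t.1 (t.2.1 + 1, t.2.2) = 0)) :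
    MovesTo (m + 1) s (slideStep t) := by
  induction h with
  | refl s => exact .step ht (.refl _)
  | step hs _ ih => exact .step hs (ih ht)

theorem MovesTo.iterate_eq {m : ℕ} {s t : (ℕ × ℕ → ℕ) × (ℕ × ℕ)} (h : MovesTo m s t) :
    slideStep^[m] s = t := by
  induction h with
  | refl s => rfl
  | step _ _ ih => rw [Function.iterate_succ_apply, ih]

/-- Once the hole is blocked, `slideStep` is the identity, so the surplus iterations in `slide` are
harmless. -/
theorem MovesTo.slide_eq {m N : ℕ} {F G : ℕ × ℕ → ℕ} {c d : ℕ × ℕ}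
    (h : MovesTo m (F, c) (G, d)) (hm : m ≤ N) (h1 : G (d.1, d.2 + 1) = 0)
    (h2 : G (d.1 + 1, d.2) = 0) : slide N F c = (G, d) := by
  have hfix : slideStep (G, d) = (G, d) := by simp [slideStep, h1, h2]
  obtain ⟨k, rfl⟩ := Nat.exists_eq_add_of_le' hm
  rw [slide, Function.iterate_add_apply, h.iterate_eq, Function.iterate_fixed hfix]

/-- A larger entry in another cell does not influence a move. -/
theorem slideStep_update {F : ℕ × ℕ → ℕ} {c p : ℕ × ℕ} {v : ℕ} (hp : F p = 0) (hpc : p ≠ c)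
    (hv : ∀ q, F q < v) (hc : ¬ (F (c.1, c.2 + 1) = 0 ∧ F (c.1 + 1, c.2) = 0)) :
    slideStep (Function.update F p v, c) =
        (Function.update (slideStep (F, c)).1 p v, (slideStep (F, c)).2) ∧
      (slideStep (F, c)).1 p = 0 ∧ p ≠ (slideStep (F, c)).2 ∧ ∀ q, (slideStep (F, c)).1 q < v := by
  have hv0 : 0 < v := (Nat.zero_le _).trans_lt (hv c)
  have key : ∀ c', F c' ≠ 0 → slideStep (F, c) =
      (Function.update (Function.update F c (F c')) c' 0, c') →
      slideStep (Function.update F p v, c) =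
      (Function.update (Function.update (Function.update F p v) c (F c')) c' 0, c') →
      slideStep (Function.update F p v, c) =
        (Function.update (slideStep (F, c)).1 p v, (slideStep (F, c)).2) ∧
      (slideStep (F, c)).1 p = 0 ∧ p ≠ (slideStep (F, c)).2 ∧
      ∀ q, (slideStep (F, c)).1 q < v := by
    intro c' hc' h1 h2
    have hpc' : p ≠ c' := fun h => hc' (h ▸ hp)
    rw [h2, h1]
    refine ⟨?_, ?_, hpc', ?_⟩
    · rw [Function.update_comm hpc, Function.update_comm hpc']
    · dsimp only
      rw [Function.update_of_ne hpc', Function.update_of_ne hpc, hp]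
    · intro q
      simp only [Function.update_apply]
      split_ifs
      · exact hv0
      · exact hv _
      · exact hv _
  by_cases hdown : F (c.1, c.2 + 1) = 0 ∨
      (F (c.1 + 1, c.2) ≠ 0 ∧ F (c.1 + 1, c.2) < F (c.1, c.2 + 1))
  · have hd0 : F (c.1 + 1, c.2) ≠ 0 := by tauto
    have hpd : (c.1 + 1, c.2) ≠ p := fun h => hd0 (h ▸ hp)
    refine key (c.1 + 1, c.2) hd0 ?_ ?_
    · simp only [slideStep]
      rw [if_neg hc, if_pos hdown]
    · simp only [slideStep]
      have hlt := hv (c.1 + 1, c.2)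
      rw [if_neg (by rw [Function.update_of_ne hpd]; tauto), if_pos, Function.update_of_ne hpd]
      rw [Function.update_of_ne hpd]
      by_cases hpr : (c.1, c.2 + 1) = p
      · rw [hpr, Function.update_self]
        exact Or.inr ⟨hd0, hlt⟩
      · rwa [Function.update_of_ne hpr]
  · have hr0 : F (c.1, c.2 + 1) ≠ 0 := by tauto
    have hpr : (c.1, c.2 + 1) ≠ p := fun h => hr0 (h ▸ hp)
    refine key (c.1, c.2 + 1) hr0 ?_ ?_
    · simp only [slideStep]
      rw [if_neg hc, if_neg hdown]
    · simp only [slideStep]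
      have hlt := hv (c.1, c.2 + 1)
      rw [if_neg (by rw [Function.update_of_ne hpr]; tauto), if_neg, Function.update_of_ne hpr]
      rw [Function.update_of_ne hpr]
      by_cases hpd : (c.1 + 1, c.2) = p
      · rw [hpd, Function.update_self]
        omega
      · rwa [Function.update_of_ne hpd]

/-- Counting only actual moves is essential: at a blocked hole the added entry might itself be the
one that moves. -/
theorem MovesTo.update {m : ℕ} {s t : (ℕ × ℕ → ℕ) × (ℕ × ℕ)} (h : MovesTo m s t) {p : ℕ × ℕ}
    {v : ℕ} (hp : s.1 p = 0) (hpc : p ≠ s.2) (hv : ∀ q, s.1 q < v) :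
    MovesTo m (Function.update s.1 p v, s.2) (Function.update t.1 p v, t.2) := by
  induction h with
  | refl s => exact .refl _
  | @step m s t hs _ ih =>
    obtain ⟨h1, h2, h3, h4⟩ := slideStep_update hp hpc hv hs
    refine .step ?_ (h1 ▸ ih h2 h3 h4)
    have hv0 : v ≠ 0 := ((Nat.zero_le _).trans_lt (hv p)).ne'
    simp only [Function.update_apply]
    split_ifs <;> simp_all

/-! ### Slides, evacuation and rectification read off from a growth diagram -/

namespace IsGrowth

variable {n : ℕ} {H V : ℕ → ℕ → ℕ × ℕ}

/-- A slide of a part of a row of a growth diagram leads to the next row. -/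
theorem exists_movesTo (h : IsGrowth n H V) {i : ℕ} (hs : IsStandard (H i) i n) {a b : ℕ}
    (hia : i ≤ a) (hab : a ≤ b) (hb : b < n) (F : ℕ × ℕ → ℕ)
    (hF : IsFill F (H i) (a + 1) (b + 1)) :
    ∃ G m, m ≤ b - a ∧ IsFill G (H (i + 1)) (a + 1) (b + 1) ∧
      MovesTo m (F, V i a) (G, V i b) ∧ G ((V i b).1, (V i b).2 + 1) = 0 ∧
      G ((V i b).1 + 1, (V i b).2) = 0 := by
  induction b, hab using Nat.le_induction generalizing F with
  | base =>
    have h0 : ∀ c, F c = 0 := fun c => hF.eq_zero (by simp)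
    exact ⟨F, 0, by omega, ⟨fun k h1 h2 => by omega, fun c hc => absurd (h0 c) hc⟩, .refl _,
      h0 _, h0 _⟩
  | succ b hab ih =>
    -- Slide without the largest entry, which sits in `p`. By `MovesTo.update` the same moves happen
    -- in its presence, and they take the hole to `V i b`.
    obtain ⟨G, m, hm, hG, hmoves, hr, hd⟩ := ih (by omega) _ (hF.dropLast (by omega))
    set p := H i (b + 1) with hp
    have hpD : p ∉ H i '' Set.Ico i (b + 1) := hs.notMem (b + 1) (by omega) hb
    have hpF : F p = b + 1 + 1 := hF.apply (b + 1) (by omega) (by omega)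
    have hD : IsLowerSet (H i '' Set.Ico i (b + 1)) := hs.lower _ (by omega)
    have hV : V i b ∉ H (i + 1) '' Set.Ico (i + 1) (b + 1) :=
      h.hole_notMem hs (by omega) (by omega)
    have hrow := h.image_row hs (show i ≤ b by omega) (by omega)
    have hVD : V i b ∈ H i '' Set.Ico i (b + 1) := hrow ▸ Set.mem_insert _ _
    have hGD : ∀ c, c ∉ H i '' Set.Ico i (b + 1) → G c = 0 := by
      intro c hc
      refine hG.eq_zero fun h' => hc (hrow ▸ Or.inr ?_)
      exact Set.image_mono (Set.Ico_subset_Ico_left (by omega)) h'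
    have hpa : p ≠ V i a := by
      intro he
      have h1 : V i a ∈ H i '' Set.Ico i (a + 1) :=
        h.image_row hs hia (by omega) ▸ Set.mem_insert _ _
      exact hpD (he ▸ Set.image_mono (Set.Ico_subset_Ico_right (by omega)) h1)
    have hmoves' := hmoves.update (p := p) (v := b + 1 + 1) (by simp) hpa
      (fun q => Nat.lt_succ_of_le ((hF.dropLast (by omega)).le q))
    simp only [Function.update_idem] at hmoves'
    rw [show Function.update F p (b + 1 + 1) = F by rw [← hpF, Function.update_eq_self]] at hmoves'
    have hrule := h.rule i b (by omega) hb
    have hnot : H (i + 1) (b + 1) ∉ H (i + 1) '' Set.Ico (a + 1) (b + 1) := fun h' =>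
      (h.standard_succ hs).notMem (b + 1) (by omega) hb
        (Set.image_mono (Set.Ico_subset_Ico_left (by omega)) h')
    have hsnoc := hG.snoc (by omega) hnot
    -- Without the largest entry the hole is blocked. With it there is exactly one more move if `p`
    -- is adjacent to the hole, and none otherwise.
    by_cases hadj : CellAdj (V i b) p
    · rw [localRule_of_adj hadj, Prod.mk.injEq] at hrule
      rw [← hrule.1] at hsnoc
      rw [← hrule.2]
      have hpos : p = ((V i b).1, (V i b).2 + 1) ∨ p = ((V i b).1 + 1, (V i b).2) :=
        adj_cases (hrow ▸ hD) (hrow ▸ hpD) hadj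
      have hstep : slideStep (Function.update G p (b + 1 + 1), V i b) =
          (Function.update G (V i b) (b + 1 + 1), p) := by
        have hne : p ≠ V i b := fun he => hpD (he ▸ hVD)
        have hfin : Function.update (Function.update (Function.update G p (b + 1 + 1)) (V i b)
            (b + 1 + 1)) p 0 = Function.update G (V i b) (b + 1 + 1) := by
          rw [Function.update_comm hne, Function.update_idem, ← Function.update_comm hne,
            show Function.update G p 0 = G by
              rw [← hGD p hpD, Function.update_eq_self]]
        rcases hpos with hpos | hpos
        · have hne' : ((V i b).1 + 1, (V i b).2) ≠ p := by rw [hpos]; simp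
          simp only [slideStep, ← hpos, Function.update_self, Function.update_of_ne hne', hd]
          simpa using hfin
        · have hne' : ((V i b).1, (V i b).2 + 1) ≠ p := by rw [hpos]; simp
          simp only [slideStep, ← hpos, Function.update_self, Function.update_of_ne hne', hr]
          simpa using hfin
      have hlast := hmoves'.snoc (by rcases hpos with hpos | hpos <;> simp [← hpos])
      rw [hstep] at hlast
      refine ⟨_, m + 1, by omega, hsnoc, hlast, ?_, ?_⟩
      -- The cells to the right of `p` and below it are outside the diagram because `p` is, so the
      -- hole is blocked again.
      · have h1 : (p.1, p.2 + 1) ∉ H i '' Set.Ico i (b + 1) := fun h' =>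
          hpD (hD (show p ≤ (p.1, p.2 + 1) from ⟨le_rfl, by simp⟩) h')
        rw [Function.update_of_ne, hGD _ h1]
        exact fun he => h1 (he ▸ hVD)
      · have h1 : (p.1 + 1, p.2) ∉ H i '' Set.Ico i (b + 1) := fun h' =>
          hpD (hD (show p ≤ (p.1 + 1, p.2) from ⟨by simp, le_rfl⟩) h')
        rw [Function.update_of_ne, hGD _ h1]
        exact fun he => h1 (he ▸ hVD)
    · rw [localRule_of_not_adj hadj, Prod.mk.injEq] at hrule
      rw [← hrule.1] at hsnoc
      rw [← hrule.2]
      refine ⟨_, m, by omega, hsnoc, hmoves', ?_, ?_⟩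
      · rw [Function.update_of_ne, hr]
        intro he
        exact hadj (by rw [← he]; simp [CellAdj])
      · rw [Function.update_of_ne, hd]
        intro he
        exact hadj (by rw [← he]; simp [CellAdj])

theorem slide_row (h : IsGrowth n H V) {i : ℕ} (hs : IsStandard (H i) i n) {a b N : ℕ}
    (hia : i ≤ a) (hab : a ≤ b) (hb : b < n) (hN : b - a ≤ N) {F : ℕ × ℕ → ℕ}
    (hF : IsFill F (H i) (a + 1) (b + 1)) :
    IsFill (slide N F (V i a)).1 (H (i + 1)) (a + 1) (b + 1) ∧ (slide N F (V i a)).2 = V i b := by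
  obtain ⟨G, m, hm, hG, hmoves, hr, hd⟩ := h.exists_movesTo hs hia hab hb F hF
  rw [hmoves.slide_eq (hm.trans hN) hr hd]
  exact ⟨hG, rfl⟩

theorem schutzDelta_row (h : IsGrowth n H V) {i : ℕ} (hs : IsStandard (H i) i n) {N : ℕ}
    (hi : i < n) (hN : n - i ≤ N) {F : ℕ × ℕ → ℕ} (hF : IsFill F (H i) i n) :
    IsFill (schutzDelta N F).1 (H (i + 1)) (i + 1) n ∧ (schutzDelta N F).2 = V i (n - 1) := by
  obtain ⟨b, rfl⟩ : ∃ b, n = b + 1 := ⟨n - 1, by omega⟩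
  have h1 := h.slide_row hs (N := N) le_rfl (show i ≤ b by omega) (by omega) (by omega)
    (hF.tail hi)
  rw [h.diag i hi, hs.first hi] at h1
  exact h1

/-- Row `i` loses the cell `V i (n - 1)`, which receives the entry `n - i`. With entries stored as
index plus one, this is the first row of the reflection. -/
theorem isFill_evac (h : IsGrowth n H V) (hs : IsStandard (H 0) 0 n) (m i : ℕ) (hi : i + m = n)
    (F : ℕ × ℕ → ℕ) (hF : IsFill F (H i) i n) :
    IsFill (evac m F) (fun j => V (n - 1 - j) (n - 1)) 0 m := by
  induction m generalizing i F with
  | zero => exact ⟨fun k _ hk => by omega, fun c hc => absurd rfl hc⟩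
  | succ m ih =>
    obtain ⟨h1, h2⟩ := h.schutzDelta_row (h.standard hs i) (N := m + 1) (by omega) (by omega) hF
    have h3 := (ih (i + 1) (by omega) _ h1).snoc (Nat.zero_le m)
      ((h.standard_reflect hs).notMem m (by omega) (by omega))
    rw [evac, h2]
    simpa only [show n - 1 - m = i by omega] using h3

theorem vacated_eq (h : IsGrowth n H V) (hs : IsStandard (H 0) 0 n) (m i : ℕ) (hi : i + m = n)
    (F : ℕ × ℕ → ℕ) (hF : IsFill F (H i) i n) :
    vacated m F = (List.range' i m).map (fun k => V k (n - 1)) := by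
  induction m generalizing i F with
  | zero => rfl
  | succ m ih =>
    obtain ⟨h1, h2⟩ := h.schutzDelta_row (h.standard hs i) (N := m + 1) (by omega) (by omega) hF
    rw [vacated, ih (i + 1) (by omega) _ h1, h2, List.range'_succ, List.map_cons]

/-- Rectification of a part of the first row of a growth diagram. -/
theorem isFill_rectify (h : IsGrowth n H V) (hs : IsStandard (H 0) 0 n) {a b N : ℕ}
    (hab : a ≤ b) (hb : b ≤ n) (hN : b - a ≤ N) {F : ℕ × ℕ → ℕ} (hF : IsFill F (H 0) a b) (r : ℕ)
    (hr : r ≤ a) :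
    IsFill (((List.range r).map (fun k => V k (a - 1))).foldl (fun F c => (slide N F c).1) F)
      (H r) a b := by
  induction r with
  | zero => exact hF
  | succ r ih =>
    rw [List.range_succ, List.map_append, List.foldl_append]
    obtain ⟨a, rfl⟩ : ∃ k, a = k + 1 := ⟨a - 1, by omega⟩
    obtain ⟨b, rfl⟩ : ∃ k, b = k + 1 := ⟨b - 1, by omega⟩
    -- In row `r` the slide of the inner entries ends at `V r a`; continuing it through the outer
    -- entries produces the same part of row `r + 1`.
    exact (h.slide_row (h.standard hs r) (by omega) (by omega) (by omega) (by omega)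
      (ih (by omega))).1

end IsGrowth

/-! ### Standard Young tableaux as words of cells -/

namespace SYT

variable {n : ℕ}

open Classical in
/-- The cell of a standard Young tableau whose entry is `k + 1`. -/
noncomputable def word (S : SYT n) (k : ℕ) : ℕ × ℕ :=
  if h : ∃ c, S.entry c = k + 1 then h.choose else (0, 0)

theorem isFill_word (S : SYT n) : IsFill S.entry S.word 0 n := by
  have key : ∀ k < n, S.entry (S.word k) = k + 1 := by
    intro k hk
    obtain ⟨c, -, hc⟩ := S.bijOn.surjOn (show k + 1 ∈ Set.Icc 1 n from ⟨by omega, by omega⟩)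
    have h : ∃ c, S.entry c = k + 1 := ⟨c, hc⟩
    rw [word, dif_pos h]
    exact h.choose_spec
  refine ⟨fun k _ hk => key k hk, fun c hc => ?_⟩
  have hc' : c ∈ S.shape := by
    by_contra h
    exact hc (S.entry_eq_zero c h)
  have h1 : 1 ≤ S.entry c ∧ S.entry c ≤ n := S.bijOn.mapsTo hc'
  have h2 := key (S.entry c - 1) (by omega)
  refine ⟨S.entry c - 1, by omega, by omega, S.bijOn.injOn ?_ hc' (by omega)⟩
  by_contra h
  rw [S.entry_eq_zero _ h] at h2
  omega

theorem entry_mono (S : SYT n) {c d : ℕ × ℕ} (hcd : c ≤ d) (hd : d ∈ S.shape) :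
    S.entry c ≤ S.entry d := by
  obtain ⟨c1, c2⟩ := c
  obtain ⟨d1, d2⟩ := d
  obtain ⟨h1, h2⟩ := Prod.mk_le_mk.1 hcd
  have h3 : S.entry (c1, d2) ≤ S.entry (d1, d2) := by
    rcases h1.eq_or_lt with rfl | h1
    · exact le_rfl
    · exact (S.col_lt _ _ _ h1 hd).le
  refine le_trans ?_ h3
  rcases h2.eq_or_lt with rfl | h2
  · exact le_rfl
  · exact (S.row_lt _ _ _ h2 (S.shape.up_left_mem h1 le_rfl hd)).le

theorem isStandard_word (S : SYT n) : IsStandard S.word 0 n where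
  lower j hj := by
    rintro p q hqp ⟨k, hk, rfl⟩
    have hk' := S.isFill_word.apply k (Nat.zero_le _) (hk.2.trans_le hj)
    have hmem : S.word k ∈ S.shape := by
      by_contra h
      rw [S.entry_eq_zero _ h] at hk'
      omega
    have hq : q ∈ S.shape := S.shape.isLowerSet hqp hmem
    have hle := S.entry_mono hqp hmem
    have hq1 : 1 ≤ S.entry q ∧ S.entry q ≤ n := S.bijOn.mapsTo hq
    obtain ⟨l, h1, h2, h3⟩ := S.isFill_word.exists_of_ne q (by omega)
    have h4 := S.isFill_word.apply l h1 h2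
    rw [h3] at h4
    exact ⟨l, ⟨h1, by have := hk.2; omega⟩, h3⟩
  notMem j _ hj := by
    rintro ⟨k, hk, he⟩
    have h1 := S.isFill_word.apply k (Nat.zero_le _) (hk.2.trans hj)
    rw [he, S.isFill_word.apply j (Nat.zero_le _) hj] at h1
    have := hk.2
    omega

theorem exists_of_isFill {F : ℕ × ℕ → ℕ} {f : ℕ → ℕ × ℕ} (hF : IsFill F f 0 n)
    (hf : IsStandard f 0 n) : ∃ S : SYT n, S.entry = F := by
  have hmem : ∀ c, F c ≠ 0 ↔ c ∈ f '' Set.Ico 0 n := fun c =>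
    Set.ext_iff.1 hF.support_eq c
  have hlt : ∀ c d : ℕ × ℕ, c ≤ d → c ≠ d → F d ≠ 0 → F c < F d := by
    intro c d hcd hne hd
    obtain ⟨k, -, hk, rfl⟩ := hF.exists_of_ne d hd
    obtain ⟨l, hl, rfl⟩ := hf.lower (k + 1) hk hcd ⟨k, ⟨Nat.zero_le _, Nat.lt_succ_self k⟩, rfl⟩
    have hlk : l ≤ k := Nat.le_of_lt_succ hl.2
    rw [hF.apply k (Nat.zero_le _) hk, hF.apply l (Nat.zero_le _) (by omega)]
    have : l ≠ k := fun h => hne (by rw [h])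
    omega
  have hfin : (f '' Set.Ico 0 n).Finite := (Set.finite_Ico 0 n).image f
  have hsh : ∀ c, c ∈ (⟨hfin.toFinset, by
      rw [Set.Finite.coe_toFinset]; exact hf.lower n le_rfl⟩ : YoungDiagram) ↔ F c ≠ 0 := by
    intro c
    rw [hmem, ← YoungDiagram.mem_cells, Set.Finite.mem_toFinset]
  refine ⟨⟨⟨hfin.toFinset, by rw [Set.Finite.coe_toFinset]; exact hf.lower n le_rfl⟩, F,
    ?_, ⟨?_, ?_, ?_⟩, ?_, ?_⟩, rfl⟩
  · intro c hc
    by_contra h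
    exact hc ((hsh c).2 h)
  · intro c hc
    have h0 := (hsh c).1 hc
    have := hF.le c
    exact ⟨by omega, this⟩
  · intro c hc d hd hcd
    obtain ⟨k, h1, h2, rfl⟩ := hF.exists_of_ne c ((hsh c).1 hc)
    obtain ⟨l, h3, h4, rfl⟩ := hF.exists_of_ne d ((hsh d).1 hd)
    rw [hF.apply k h1 h2, hF.apply l h3 h4] at hcd
    rw [show k = l by omega]
  · rintro x ⟨hx1, hx2⟩
    have h := hF.apply (x - 1) (Nat.zero_le _) (by omega)
    exact ⟨f (x - 1), (hsh _).2 (by omega), by omega⟩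
  · intro i j₁ j₂ hj hmem
    exact hlt _ _ ⟨le_rfl, hj.le⟩ (by simp [hj.ne]) ((hsh _).1 hmem)
  · intro i₁ i₂ j hi hmem
    exact hlt _ _ ⟨hi.le, le_rfl⟩ (by simp [hi.ne]) ((hsh _).1 hmem)

/-- The tableau `S_{[i,j]}`, before `i - 1` is subtracted from its entries, is given by a row of
the growth diagram. -/
theorem exists_isFill_seg (S : SYT n) {H V : ℕ → ℕ → ℕ × ℕ} (h : IsGrowth n H V)
    (hw : ∀ k < n, H 0 k = S.word k) {i j : ℕ} (hi : 1 ≤ i) (hij : i < j) (hj : j ≤ n) :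
    ∃ G, IsFill G (H (i - 1)) (i - 1) j ∧ S.seg i j = fun c => G c - (i - 1) := by
  have hfill : IsFill S.entry (H 0) 0 n := S.isFill_word.congr fun k _ hk => (hw k hk).symm
  have hs : IsStandard (H 0) 0 n := by
    have him : ∀ k ≤ n, H 0 '' Set.Ico 0 k = S.word '' Set.Ico 0 k := fun k hk =>
      Set.image_congr fun l hl => hw l (hl.2.trans_le hk)
    exact ⟨fun k hk => him k hk ▸ S.isStandard_word.lower k hk,
      fun k h0 hk => him k hk.le ▸ hw k hk ▸ S.isStandard_word.notMem k h0 hk⟩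
  have hinner := hfill.restrict (a' := 0) (b' := i - 1) le_rfl (by omega) (P := fun x => x < i)
    (fun x _ _ => by omega)
  have hskew := hfill.restrict (a' := i - 1) (b' := j) (by omega) hj
    (P := fun x => i ≤ x ∧ x ≤ j) (fun x _ _ => by omega)
  -- The diagram truncated to size `i - 1` is that of the inner tableau, so the holes at the end of
  -- its rows are the cells used for rectification.
  have hvac := (h.mono (show i - 1 ≤ n by omega)).vacated_eq (hs.mono (by omega)) (i - 1) 0
    (by omega) _ hinner
  refine ⟨_, h.isFill_rectify hs (N := n) (by omega) hj (by omega) hskew (i - 1) le_rfl, ?_⟩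
  rw [List.range_eq_range', ← hvac]
  rfl

end SYT

/-! ### Descents -/

/-- The cell `f (j + 1)` is not in a column to the right of the one of `f j`. -/
def HasDescent (f : ℕ → ℕ × ℕ) (j : ℕ) : Prop := (f (j + 1)).2 ≤ (f j).2

/-- Two different cells which can be added to the same diagram are in different columns. -/
theorem col_ne_of_addable {M : Set (ℕ × ℕ)} {a b : ℕ × ℕ} (ha : a ∉ M) (hb : b ∉ M) (hab : a ≠ b)
    (hal : IsLowerSet (insert a M)) (hbl : IsLowerSet (insert b M)) : a.2 ≠ b.2 := by
  intro h
  rcases le_total a.1 b.1 with h' | h'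
  · rcases hbl (show a ≤ b from ⟨h', h.le⟩) (Set.mem_insert _ _) with h1 | h1
    · exact hab h1
    · exact ha h1
  · rcases hal (show b ≤ a from ⟨h', h.ge⟩) (Set.mem_insert _ _) with h1 | h1
    · exact hab h1.symm
    · exact hb h1

/-- Three cells which are added one after the other do not form a hook with its bend in the
second cell. -/
theorem not_bend {M : Set (ℕ × ℕ)} {a b c d : ℕ × ℕ} (ha : a ∉ M) (hM : IsLowerSet M)
    (hc : IsLowerSet (insert c (insert b (insert a M)))) (hdc : d ≤ c) (had : a ≤ d)
    (h1 : d ≠ a) (h2 : d ≠ b) (h3 : d ≠ c) : False := by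
  rcases hc hdc (Set.mem_insert _ _) with h | h | h | h
  · exact h3 h
  · exact h2 h
  · exact h1 h
  · exact ha (hM had h)

/-- If the hole meets both letters, the three cells lie on a line, since a bend would need a missing
corner. If only one letter moves, its column changes by at most one, and a comparison could change
only if two cells addable to the same diagram shared a column. -/
theorem localRule_descent {M : Set (ℕ × ℕ)} {a b c a' b' c' a'' : ℕ × ℕ} (hM : IsLowerSet M)
    (ha : a ∉ M) (hal : IsLowerSet (insert a M)) (hb : b ∉ insert a M)
    (hbl : IsLowerSet (insert b (insert a M))) (hc : c ∉ insert b (insert a M))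
    (hcl : IsLowerSet (insert c (insert b (insert a M))))
    (h1 : localRule a b = (b', a')) (h2 : localRule a' c = (c', a'')) :
    c'.2 ≤ b'.2 ↔ c.2 ≤ b.2 := by
  by_cases hab : CellAdj a b
  · rw [localRule_of_adj hab, Prod.mk.injEq] at h1
    obtain ⟨rfl, rfl⟩ := h1
    have hpos := adj_cases hal hb hab
    by_cases hbc : CellAdj b c
    · rw [localRule_of_adj hbc, Prod.mk.injEq] at h2
      obtain ⟨rfl, rfl⟩ := h2
      have hpos' := adj_cases hbl hc hbc
      obtain ⟨a1, a2⟩ := a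
      rcases hpos with rfl | rfl <;> rcases hpos' with rfl | rfl
      · simp
      · exact (not_bend (d := (a1 + 1, a2)) ha hM hcl (by simp) (by simp) (by simp) (by simp)
          (by simp)).elim
      · exact (not_bend (d := (a1, a2 + 1)) ha hM hcl (by simp) (by simp) (by simp) (by simp)
          (by simp)).elim
      · simp
    · rw [localRule_of_not_adj hbc, Prod.mk.injEq] at h2
      obtain ⟨rfl, rfl⟩ := h2
      have hne : b ≠ c := fun h => hc (h ▸ Set.mem_insert _ _)
      have hcol := col_ne_of_addable hb (fun h => hc (Or.inr h)) hne hbl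
        (isLowerSet_insert_of_not_adj hal hb hc hcl hbc)
      rcases hpos with rfl | rfl
      · simp only at hcol ⊢
        omega
      · simp
  · rw [localRule_of_not_adj hab, Prod.mk.injEq] at h1
    obtain ⟨rfl, rfl⟩ := h1
    by_cases hac : CellAdj a c
    · rw [localRule_of_adj hac, Prod.mk.injEq] at h2
      obtain ⟨rfl, rfl⟩ := h2
      have hne : a ≠ b := fun h => hb (h ▸ Set.mem_insert _ _)
      have hcol := col_ne_of_addable ha (fun h => hb (Or.inr h)) hne hal
        (isLowerSet_insert_of_not_adj hM ha hb hbl hab)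
      rcases adj_cases hal (fun h => hc (Or.inr h)) hac with rfl | rfl
      · simp only at hcol ⊢
        omega
      · simp
    · rw [localRule_of_not_adj hac, Prod.mk.injEq] at h2
      obtain ⟨rfl, rfl⟩ := h2
      exact Iff.rfl

namespace IsGrowth

variable {n : ℕ} {H V : ℕ → ℕ → ℕ × ℕ}

theorem hasDescent_succ (h : IsGrowth n H V) {i : ℕ} (hs : IsStandard (H i) i n) {j : ℕ}
    (hij : i < j) (hj : j + 1 < n) : HasDescent (H (i + 1)) j ↔ HasDescent (H i) j := by
  obtain ⟨j, rfl⟩ : ∃ k, j = k + 1 := ⟨j - 1, by omega⟩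
  obtain ⟨h1, h2, h3, -⟩ := h.next_aux hs j (by omega) (by omega)
  have e1 := image_Ico_succ (H i) (i := i) (j := j + 1) (by omega)
  have e2 := image_Ico_succ (H i) (i := i) (j := j + 1 + 1) (by omega)
  have l1 := hs.lower (j + 1) (by omega)
  have l2 := hs.lower (j + 1 + 1) (by omega)
  have l3 := hs.lower (j + 1 + 1 + 1) (by omega)
  have n2 := hs.notMem (j + 1) (by omega) (by omega)
  have n3 := hs.notMem (j + 1 + 1) (by omega) (by omega)
  rw [e2] at l3
  rw [e1] at l2 l3 n3
  rw [h3] at l1 l2 l3 n2 n3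
  exact localRule_descent h1 h2 l1 n2 l2 n3 l3 (h.rule i j (by omega) (by omega))
    (h.rule i (j + 1) (by omega) (by omega))

theorem hasDescent_row (h : IsGrowth n H V) (hs : IsStandard (H 0) 0 n) {i j : ℕ} (hij : i ≤ j)
    (hj : j + 1 < n) : HasDescent (H i) j ↔ HasDescent (H 0) j := by
  induction i with
  | zero => exact Iff.rfl
  | succ i ih => rw [h.hasDescent_succ (h.standard hs i) (by omega) hj, ih (by omega)]

/-- The second letter of a row of a growth diagram is next to the first one. -/
theorem hole_succ (h : IsGrowth n H V) {i : ℕ} (hs : IsStandard (H i) i n) (hi : i + 1 < n) :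
    V i (i + 1) = H i (i + 1) := by
  have hrule := h.rule i i le_rfl hi
  rw [h.diag i (by omega)] at hrule
  have hadj : CellAdj (H i i) (H i (i + 1)) := by
    by_contra hadj
    have hl := hs.lower (i + 1 + 1) hi
    have h0 : H i '' Set.Ico i i = ∅ := by simp
    rw [image_Ico_succ _ (by omega), image_Ico_succ _ le_rfl, h0] at hl
    have hn := hs.notMem (i + 1) (by omega) hi
    rw [image_Ico_succ _ le_rfl, h0] at hn
    have := isLowerSet_insert_of_not_adj isLowerSet_empty (Set.notMem_empty _) hn hl hadj
      (show (H i i) ≤ H i (i + 1) by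
        rw [hs.first (by omega)]; exact ⟨Nat.zero_le _, Nat.zero_le _⟩) (Set.mem_insert _ _)
    rcases this with h' | h'
    · exact hn (h' ▸ Set.mem_insert _ _)
    · exact h'
  rw [localRule_of_adj hadj] at hrule
  exact (Prod.mk.inj hrule).2.symm

/-- Reflection reverses the sequence of descents. -/
theorem hasDescent_reflect (h : IsGrowth n H V) (hs : IsStandard (H 0) 0 n) {j : ℕ}
    (hj : j + 1 < n) :
    HasDescent (fun j => V (n - 1 - j) (n - 1)) j ↔ HasDescent (H 0) (n - 2 - j) := by
  -- Going down to the row which starts at the descent makes its first cell `(0, 0)`. There the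
  -- reflected and the original row have the same second cell, by `hole_succ`.
  have h1 := h.reflect.hasDescent_row (by simpa using h.standard_reflect hs) (i := j) le_rfl hj
  simp only [Nat.sub_zero] at h1
  rw [← h1, ← h.hasDescent_row hs (i := n - 2 - j) le_rfl (by omega)]
  simp only [HasDescent]
  rw [h.diag (n - 1 - j) (by omega), (h.standard hs _).first (by omega),
    (h.standard hs (n - 2 - j)).first (by omega), show n - 1 - (j + 1) = n - 2 - j by omega,
    show n - 1 - j = n - 2 - j + 1 by omega, h.hole_succ (h.standard hs _) (by omega)]

end IsGrowth

/-! ### Sequences of horizontal strips -/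

/-- A boundary `m` of `s` missing from `t` is neither `0` nor `n`, so `m` and `m + 1` share a block
of `t` but not of `s`. -/
theorem setPartition_le_iff {n : ℕ} (t s : CompositionAsSet n) :
    setPartition t ≤ setPartition s ↔ s.boundaries ⊆ t.boundaries := by
  constructor
  · intro h m hm
    by_contra hmt
    have h0 : (m : ℕ) ≠ 0 := by
      intro h0
      exact hmt ((Fin.ext h0 : m = 0) ▸ t.zero_mem)
    have hn : (m : ℕ) ≠ n := by
      intro hn
      exact hmt ((Fin.ext hn : m = Fin.last n) ▸ t.getLast_mem)
    have hlt := m.isLt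
    have hxy : setPartition t ⟨m - 1, by omega⟩ ⟨m, by omega⟩ := by
      intro k hk
      have hkm : (k : ℕ) ≠ m := fun h' => hmt ((Fin.ext h' : k = m) ▸ hk)
      simp only
      omega
    have := (h hxy m hm).1 (by simp only; omega)
    simp only at this
    omega
  · intro h x y hxy m hm
    exact hxy m (h hm)

namespace SYT

variable {n : ℕ}

theorem eq_word (S : SYT n) {p : ℕ × ℕ} {k : ℕ} (h : S.entry p = k + 1) : p = S.word k := by
  obtain ⟨l, h1, h2, rfl⟩ := S.isFill_word.exists_of_ne p (by omega)
  rw [S.isFill_word.apply l h1 h2] at h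
  rw [show l = k by omega]

/-- Columns need to be compared only for consecutive numbers; inside a block the inequalities chain
up. -/
theorem isStripChain_iff (S : SYT n) (s : CompositionAsSet n) :
    S.IsStripChain s ↔ ∀ j, ∀ hj : j + 1 < n, HasDescent S.word j →
      (⟨j + 1, by omega⟩ : Fin n.succ) ∈ s.boundaries := by
  constructor
  · intro h j hj hdes
    by_contra hmem
    have hlt := h ⟨j, by omega⟩ ⟨j + 1, hj⟩ (Fin.mk_lt_mk.2 (Nat.lt_succ_self j)) (by
      intro m hm
      have hne : (m : ℕ) ≠ j + 1 := fun h' => hmem (by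
        rwa [show (⟨j + 1, by omega⟩ : Fin n.succ) = m from Fin.ext h'.symm])
      simp only
      omega) (S.word j) (S.word (j + 1)) (S.isFill_word.apply _ (Nat.zero_le _) (by omega))
      (S.isFill_word.apply _ (Nat.zero_le _) (by omega))
    unfold HasDescent at hdes
    omega
  · intro h x y hxy hpart p q hp hq
    rw [S.eq_word hp, S.eq_word hq]
    have key : ∀ d, (x : ℕ) + d + 1 ≤ y → (S.word x).2 < (S.word (x + d + 1)).2 := by
      have step : ∀ k, (x : ℕ) ≤ k → k < y → (S.word k).2 < (S.word (k + 1)).2 := by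
        intro k hxk hky
        by_contra hcon
        have hm := h k (by omega) (Nat.le_of_not_lt hcon)
        have := (hpart _ hm).1 (by simp only; omega)
        simp only at this
        omega
      intro d hd
      induction d with
      | zero => exact step x le_rfl hd
      | succ d ih => exact (ih (by omega)).trans (step (x + d + 1) (by omega) hd)
    have hlt : (x : ℕ) < y := hxy
    have := key (y - x - 1) (by omega)
    rwa [show (x : ℕ) + (y - x - 1) + 1 = y by omega] at this

/-- The ends and the descents form a strip chain contained in every other one, so minimality of the
length forces equality. -/
theorem mem_boundaries_SHS (S : SYT n) (m : Fin n.succ) :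
    m ∈ S.SHS.boundaries ↔
      (m : ℕ) = 0 ∨ (m : ℕ) = n ∨ ∃ j, (m : ℕ) = j + 1 ∧ j + 1 < n ∧ HasDescent S.word j := by
  classical
  obtain ⟨hchain, hmin⟩ := Classical.choose_spec S.exists_growthChain
  change S.IsStripChain S.SHS at hchain
  change ∀ s', S.IsStripChain s' → S.SHS.length ≤ s'.length at hmin
  let s : CompositionAsSet n :=
    ⟨Finset.univ.filter fun m : Fin n.succ =>
      (m : ℕ) = 0 ∨ (m : ℕ) = n ∨ ∃ j, (m : ℕ) = j + 1 ∧ j + 1 < n ∧ HasDescent S.word j,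
      by simp, by simp⟩
  have hs : S.IsStripChain s := (S.isStripChain_iff s).2 fun j hj hdes => by
    simp only [s, Finset.mem_filter, Finset.mem_univ, true_and]
    exact Or.inr (Or.inr ⟨j, rfl, hj, hdes⟩)
  have hsub : s.boundaries ⊆ S.SHS.boundaries := by
    intro k hk
    simp only [s, Finset.mem_filter, Finset.mem_univ, true_and] at hk
    rcases hk with hk | hk | ⟨j, hk, hj, hdes⟩
    · exact (Fin.ext hk : k = 0) ▸ S.SHS.zero_mem
    · exact (Fin.ext hk : k = Fin.last n) ▸ S.SHS.getLast_mem
    · have := (S.isStripChain_iff _).1 hchain j hj hdes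
      rwa [show (⟨j + 1, by omega⟩ : Fin n.succ) = k from Fin.ext hk.symm] at this
  have hcard := hmin s hs
  have h1 := s.card_boundaries_eq_succ_length
  have h2 := S.SHS.card_boundaries_eq_succ_length
  rw [← Finset.eq_of_subset_of_card_le hsub (by omega)]
  simp [s]

end SYT

/-! ### Evacuation -/

namespace SYT

variable {n : ℕ}

theorem support_seg (S : SYT n) {H V : ℕ → ℕ → ℕ × ℕ} (h : IsGrowth n H V)
    (hw : ∀ k < n, H 0 k = S.word k) {i j : ℕ} (hi : 1 ≤ i) (hij : i < j) (hj : j ≤ n) :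
    Function.support (S.seg i j) = H (i - 1) '' Set.Ico (i - 1) j := by
  obtain ⟨G, hG, hseg⟩ := S.exists_isFill_seg h hw hi hij hj
  rw [hseg, ← hG.support_eq]
  ext c
  simp only [Function.mem_support]
  constructor
  · intro h0 h1
    rw [h1] at h0
    omega
  · intro h0
    obtain ⟨k, h1, h2, rfl⟩ := hG.exists_of_ne c h0
    rw [hG.apply k h1 h2]
    omega

theorem seg_eq_iff (S T : SYT n) {H V H' V' : ℕ → ℕ → ℕ × ℕ} (h : IsGrowth n H V)
    (hw : ∀ k < n, H 0 k = S.word k) (h' : IsGrowth n H' V') (hw' : ∀ k < n, H' 0 k = T.word k)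
    {i j : ℕ} (hi : 1 ≤ i) (hij : i < j) (hj : j ≤ n) :
    S.seg i j = T.seg i j ↔ ∀ k, i - 1 ≤ k → k < j → H (i - 1) k = H' (i - 1) k := by
  obtain ⟨G, hG, hseg⟩ := S.exists_isFill_seg h hw hi hij hj
  obtain ⟨G', hG', hseg'⟩ := T.exists_isFill_seg h' hw' hi hij hj
  rw [← hG.eq_iff hG', hseg, hseg']
  -- All nonzero entries exceed `i - 1`, so the truncated subtraction loses no information.
  have key : ∀ {F : ℕ × ℕ → ℕ} {f : ℕ → ℕ × ℕ}, IsFill F f (i - 1) j →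
      ∀ c, F c = 0 ∨ i - 1 < F c := by
    intro F f hF c
    by_cases hc : F c = 0
    · exact Or.inl hc
    · obtain ⟨k, h1, h2, rfl⟩ := hF.exists_of_ne c hc
      rw [hF.apply k h1 h2]
      omega
  constructor
  · intro he
    funext c
    have h1 := congrFun he c
    have h2 := key hG c
    have h3 := key hG' c
    omega
  · rintro rfl
    rfl

theorem exists_evac (S : SYT n) : ∃ T : SYT n, T.entry = evac n S.entry := by
  have hg := isGrowth_growthRow n S.word
  have hs : IsStandard (growthRow S.word 0) 0 n := S.isStandard_word
  exact exists_of_isFill (hg.isFill_evac hs n 0 (by omega) _ S.isFill_word) (hg.standard_reflect hs)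

/-- Schützenberger's evacuation of a standard Young tableau. -/
noncomputable def evacuation (S : SYT n) : SYT n := S.exists_evac.choose

theorem entry_evacuation (S : SYT n) : S.evacuation.entry = evac n S.entry :=
  S.exists_evac.choose_spec

theorem word_evacuation (S : SYT n) {H V : ℕ → ℕ → ℕ × ℕ} (h : IsGrowth n H V)
    (hw : H 0 = S.word) (k : ℕ) (hk : k < n) : V (n - 1 - k) (n - 1) = S.evacuation.word k := by
  have hs : IsStandard (H 0) 0 n := hw ▸ S.isStandard_word
  have h1 := h.isFill_evac hs n 0 (by omega) S.entry (hw ▸ S.isFill_word)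
  rw [← S.entry_evacuation] at h1
  exact (h1.eq_iff S.evacuation.isFill_word).1 rfl k (Nat.zero_le _) hk

/-- The diagram of the evacuation agrees with the reflection on the triangle, and the last column of
the reflection is the original first row. -/
theorem evacuation_evacuation (S : SYT n) : S.evacuation.evacuation = S := by
  have hg := isGrowth_growthRow n S.word
  have hg' := isGrowth_growthRow n S.evacuation.word
  have hw := S.word_evacuation hg rfl
  refine ext_entry ((S.evacuation.evacuation.isFill_word.eq_iff S.isFill_word).2 fun k _ hk => ?_)
  rw [← S.evacuation.word_evacuation hg' rfl k hk]
  have h1 := (hg.reflect.congr hg' le_rfl (a := 0) (fun j _ hj => ?_) (n - 1 - k) (n - 1)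
    (Nat.zero_le _) (by omega) (by omega)).2
  · rw [← h1]
    simp only [Nat.sub_self, show n - 1 - (n - 1 - k) = k by omega]
    rfl
  · exact hw j hj

theorem support_seg_evacuation (S : SYT n) {i j : ℕ} (hi : 1 ≤ i) (hij : i < j) (hj : j ≤ n) :
    Function.support (S.evacuation.seg i j) =
      Function.support (S.seg (n + 1 - j) (n + 1 - i)) := by
  have hg := isGrowth_growthRow n S.word
  rw [S.evacuation.support_seg hg.reflect (by simpa using S.word_evacuation hg rfl) hi hij hj,
    S.support_seg hg (fun _ _ => rfl) (by omega) (by omega) (by omega),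
    hg.image_reflect_row S.isStandard_word (by omega) hj,
    show n + 1 - j - 1 = n - j by omega, show n + 1 - i = n - (i - 1) by omega]

/-- The segments of the evacuations are pieces of the column `n - i`; `row_eq_iff` trades these for
the parts of row `n - j` over the same triangle. -/
theorem seg_evacuation_eq_iff (S T : SYT n) {i j : ℕ} (hi : 1 ≤ i) (hij : i < j) (hj : j ≤ n) :
    S.evacuation.seg i j = T.evacuation.seg i j ↔
      S.seg (n + 1 - j) (n + 1 - i) = T.seg (n + 1 - j) (n + 1 - i) := by
  have hS := isGrowth_growthRow n S.word
  have hT := isGrowth_growthRow n T.word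
  rw [seg_eq_iff S.evacuation T.evacuation hS.reflect (by simpa using S.word_evacuation hS rfl)
      hT.reflect (by simpa using T.word_evacuation hT rfl) hi hij hj,
    seg_eq_iff S T hS (fun _ _ => rfl) hT (fun _ _ => rfl) (by omega) (by omega) (by omega),
    hS.row_eq_iff hT (by omega)]
  simp only [show n + 1 - i - 1 = n - 1 - (i - 1) by omega]
  constructor
  · intro h k h1 h2
    have := h (n - 1 - k) (by omega) (by omega)
    rwa [show n - 1 - (n - 1 - k) = k by omega] at this
  · intro h k h1 h2
    exact h (n - 1 - k) (by omega) (by omega)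

theorem boundaries_SHS_evacuation (S : SYT n) :
    S.evacuation.SHS.boundaries = S.SHS.boundaries.map Fin.revPerm.toEmbedding := by
  have hg := isGrowth_growthRow n S.word
  have hw := S.word_evacuation hg rfl
  have hdes : ∀ j, j + 1 < n →
      (HasDescent S.evacuation.word j ↔ HasDescent S.word (n - 2 - j)) := by
    intro j hj
    rw [show S.word = growthRow S.word 0 from rfl, ← hg.hasDescent_reflect S.isStandard_word hj]
    simp only [HasDescent]
    rw [hw j (by omega), hw (j + 1) hj]
  ext m
  have hm := m.isLt
  have hrev : (m.rev : ℕ) = n - m := by rw [Fin.val_rev]; omega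
  rw [Finset.mem_map_equiv, Fin.revPerm_symm, Fin.revPerm_apply, mem_boundaries_SHS,
    mem_boundaries_SHS, hrev]
  constructor
  · rintro (h | h | ⟨j, h1, h2, h3⟩)
    · exact Or.inr (Or.inl (by omega))
    · exact Or.inl (by omega)
    · exact Or.inr (Or.inr ⟨n - 2 - j, by omega, by omega, (hdes j h2).1 h3⟩)
  · rintro (h | h | ⟨j, h1, h2, h3⟩)
    · exact Or.inr (Or.inl (by omega))
    · exact Or.inl (by omega)
    · refine Or.inr (Or.inr ⟨n - 2 - j, by omega, by omega, (hdes _ (by omega)).2 ?_⟩)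
      rwa [show n - 2 - (n - 2 - j) = j by omega]

theorem ChainStripRel.evacuation {S T : SYT n} (h : ChainStripRel S T) :
    ChainStripRel S.evacuation T.evacuation := by
  refine ⟨fun i j hi hij hj => ?_, ?_⟩
  · rw [support_seg_evacuation S hi hij hj, support_seg_evacuation T hi hij hj,
      seg_evacuation_eq_iff S T hi hij hj]
    exact h.1 _ _ (by omega) (by omega) (by omega)
  · have hS := S.boundaries_SHS_evacuation
    have hT := T.boundaries_SHS_evacuation
    rcases h.2 with h2 | ⟨h2, h3⟩
    · left
      ext1
      rw [hS, hT, h2]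
    · right
      refine ⟨?_, ?_⟩
      · rw [setPartition_le_iff] at h2 ⊢
        rw [hS, hT]
        exact Finset.map_subset_map.2 h2
      · unfold CompositionAsSet.length at h3 ⊢
        rw [hS, hT, Finset.card_map, Finset.card_map, h3]

theorem evacuation_mono {S T : SYT n} (h : S ≤ T) : S.evacuation ≤ T.evacuation := by
  induction h with
  | single h => exact .single h.evacuation
  | tail _ h ih => exact ih.tail h.evacuation

end SYT

/-- For each `n`, evacuation is an automorphism of the chain-strip order on `SYT n`. -/
theorem mainTheorem2 (n : ℕ) :
    ∃ e : SYT n ≃o SYT n, ∀ T : SYT n, (e T).entry = evac n T.entry := by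
  refine ⟨⟨⟨SYT.evacuation, SYT.evacuation, SYT.evacuation_evacuation,
    SYT.evacuation_evacuation⟩, fun {S T} => ⟨fun h => ?_, SYT.evacuation_mono⟩⟩,
    SYT.entry_evacuation⟩
  -- Monotonicity of an involution already gives the converse implication.
  have := SYT.evacuation_mono h
  simpa only [Equiv.coe_fn_mk, SYT.evacuation_evacuation] using this
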